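/- Let $\ell$ be the horizontal axis of the Euclidean plane, and let $\gamma$ be a strictly convex closed curve (the boundary of a compact strictly convex set with nonempty interior; no smoothness is assumed) lying in the open upper half-plane. A tangent segment from a point $x$ to $\gamma$ is a segment $xp$ with $p\in\gamma$, $p \ne x$, such that the line $xp$ is a support line of $\gamma$; from every point $x\in\ell$ there are exactly two of them. Then the two tangent segments to $\gamma$ from every point of $\ell$ have equal Euclidean lengths if and only if $\gamma$ is a curve of constant width in the hyperbolic metric, the upper half-plane being considered as the upper half-plane model of the hyperbolic plane. Here $\gamma$ has constant hyperbolic width if the region $K$ bounded by $\gamma$ is convex in the hyperbolic metric and there is a number $d$ such that for every supporting geodesic $L$ of $K$ the largest hyperbolic distance from a point of $K$ to $L$ equals $d$. -/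

import Mathlib

open scoped UpperHalfPlane ComplexConjugate

/-- A strictly convex closed curve in the plane `ℂ`, given by its set of points: the boundary of a
compact strictly convex set with nonempty interior. No smoothness is required (corners are
allowed). -/
def IsStrictlyConvexClosedCurve (γ : Set ℂ) : Prop :=
  ∃ K : Set ℂ, IsCompact K ∧ StrictConvex ℝ K ∧ (interior K).Nonempty ∧ frontier K = γ

/-- The segment from `x` to `p` is a tangent segment to the closed curve `γ`: its endpoint `p ≠ x`
lies on `γ`, and the straight line through `x` and `p` is a support line of `γ`, that is, `γ` lies
in one of the two closed half-planes bounded by that line.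
(`((z - x) * conj (p - x)).im` is the determinant of the pair of vectors `p - x`, `z - x`.) -/
def IsTangentSegment (γ : Set ℂ) (x p : ℂ) : Prop :=
  p ∈ γ ∧ p ≠ x ∧
    ((∀ z ∈ γ, 0 ≤ ((z - x) * conj (p - x)).im) ∨ (∀ z ∈ γ, ((z - x) * conj (p - x)).im ≤ 0))

/-- All tangent segments (for a strictly convex closed curve and a point outside it: the two
tangent segments) from the point `x` to the curve `γ` have the same Euclidean length. -/
def EqualTangentSegments (γ : Set ℂ) (x : ℂ) : Prop :=
  ∀ p q : ℂ, IsTangentSegment γ x p → IsTangentSegment γ x q → dist x p = dist x q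

/-- The complete geodesics of the hyperbolic plane in the upper half-plane model: vertical
half-lines, and semicircles centered on the horizontal axis. -/
inductive HypLine : Type
  | vertical (a : ℝ) : HypLine
  | semicircle (c r : ℝ) (hr : 0 < r) : HypLine

namespace HypLine

/-- A function that vanishes on the geodesic, and is positive on one and negative on the other of
its two open half-planes. -/
noncomputable def side : HypLine → ℍ → ℝ
  | vertical a, z => z.re - a
  | semicircle c r _, z => dist (z : ℂ) (c : ℂ) - r

/-- The set of points of a geodesic. -/
def points (L : HypLine) : Set ℍ := {z | L.side z = 0}

/-- `L` is a supporting geodesic of `K`: it meets `K`, and `K` lies in one of the two closed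
half-planes bounded by `L`. -/
def Supports (L : HypLine) (K : Set ℍ) : Prop :=
  (L.points ∩ K).Nonempty ∧ ((∀ z ∈ K, 0 ≤ L.side z) ∨ (∀ z ∈ K, L.side z ≤ 0))

end HypLine

/-- The geodesic segment joining two points of the hyperbolic plane. -/
def hypSegment (z w : ℍ) : Set ℍ := {u | dist z u + dist u w = dist z w}

/-- Convex bodies of the hyperbolic plane. -/
def IsHypConvexBody (K : Set ℍ) : Prop :=
  IsCompact K ∧ (interior K).Nonempty ∧ ∀ z ∈ K, ∀ w ∈ K, hypSegment z w ⊆ K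

/-- The hyperbolic width of `K` with respect to a supporting geodesic `L`: the largest hyperbolic
distance from `L` to a point of `K`. -/
noncomputable def hypWidth (K : Set ℍ) (L : HypLine) : ℝ :=
  sSup ((fun z => Metric.infDist z L.points) '' K)

/-- Convex bodies of constant width in the hyperbolic plane: the width is the same with respect to
all supporting geodesics. -/
def IsHypConstantWidthBody (K : Set ℍ) : Prop :=
  IsHypConvexBody K ∧ ∃ d : ℝ, ∀ L : HypLine, L.Supports K → hypWidth K L = d

/-- A convex closed curve `γ` in the upper half-plane has constant width in the hyperbolic metric:
the region that it bounds is a hyperbolic convex body of constant width. -/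
def IsHypConstantWidthCurve (γ : Set ℂ) : Prop :=
  IsHypConstantWidthBody {z : ℍ | (z : ℂ) ∈ convexHull ℝ γ}

/-! For real `x`, the support lines through `x` touch the body `K` at the maximizer `p` and the
minimizer `q` of `slope x`, and `arsinh (slope x z)` is the signed distance from `z` to the vertical
geodesic at `x`. Everything rests on `cosh_dist_eq_cosh_sub_add`: the difference of these signed
distances is at most `dist z w`, with equality when `z` and `w` lie on one Euclidean circle about
`x`, a geodesic perpendicular to that vertical.

Equal tangents give constant width. By the envelope theorem `slope x p` has derivative `-1 / p.im`
in `x`, so its `arsinh` has derivative `-1 / |x - p|`; likewise for `q`. Equal lengths therefore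
make the difference of the two signed distances a constant `d`, which is also `dist p q`. Taking `x`
equidistant from two given points of `K` shows that the diameter is at most `d`. A point outside `K`
is separated from it by a line, and the contact point on the opposite side for the foot of that line
is more than `d` away; so `K` is an intersection of balls of radius `d`, hence hyperbolically
convex. The Euclidean tangent to a supporting geodesic at a point `o` of `K` is a support line, so
`o` is `p` or `q` for some `x`, and the other contact point has foot `o` and distance `d`.
Horizontal tangents arise as limits `x → ∞`.

Conversely, constant width `d` bounds the diameter by `d`. The geodesic `L` tangent at `p` to the
line `xp` supports `K`; a point `q'` of `K` farthest from `L` is at distance `d`, so its foot is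
`p`, which puts it on the circle about `x` through `p`. The diameter bound makes `q'` a minimizer of
`slope x`, and strict convexity gives `q' = q`. -/

open Filter Topology

/-! ### Hyperboloid coordinates, geodesic segments, convexity of balls -/

namespace UpperHalfPlane

/-- The restriction to the hyperbolic plane of the linear form on Minkowski space with
coefficients `A`, `B`, `C`, in the hyperboloid coordinates `|z|² / im z`, `re z / im z`,
`1 / im z`. -/
noncomputable def linForm (A B C : ℝ) (z : ℍ) : ℝ :=
  (A * (z.re ^ 2 + z.im ^ 2) + B * z.re + C) / z.im

/-- The hyperbolic sine of the signed distance to the vertical geodesic ending at `x`; it is the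
inverse slope of the straight line through `x` and `z`. -/
noncomputable def slope (x : ℝ) (z : ℍ) : ℝ := (z.re - x) / z.im

lemma slope_eq_linForm (x : ℝ) (z : ℍ) : slope x z = linForm 0 1 (-x) z := by
  simp only [slope, linForm]; ring

lemma cosh_dist_eq (z w : ℍ) :
    Real.cosh (dist z w) = ((z.re - w.re) ^ 2 + z.im ^ 2 + w.im ^ 2) / (2 * z.im * w.im) :=
  cosh_dist' z w

lemma cosh_dist_eq_linForm (w z : ℍ) : Real.cosh (dist w z) =
    linForm (1 / (2 * w.im)) (-(w.re / w.im)) ((w.re ^ 2 + w.im ^ 2) / (2 * w.im)) z := by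
  have := w.im_pos; have := z.im_pos
  rw [cosh_dist_eq, linForm]; field_simp; ring

lemma continuous_linForm (A B C : ℝ) : Continuous (linForm A B C) := by
  unfold linForm
  exact Continuous.div (by have := continuous_re; have := continuous_im; fun_prop) continuous_im
    fun z => z.im_ne_zero

lemma continuous_slope (x : ℝ) : Continuous (slope x) := by
  rw [funext (slope_eq_linForm x)]
  exact continuous_linForm 0 1 (-x)

/-- The hypotheses describe the upper sheet of the hyperboloid; the coordinates invert to `im = 1 /
R` and `re = Q / R`. -/
lemma exists_linForm_eq {P Q R : ℝ} (hR : 0 < R) (h : P * R = Q ^ 2 + 1) :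
    ∃ u : ℍ, ∀ A B C, linForm A B C u = A * P + B * Q + C * R := by
  refine ⟨⟨⟨Q / R, 1 / R⟩, by positivity⟩, fun A B C => ?_⟩
  have hP : P = (Q ^ 2 + 1) / R := by rw [← h]; field_simp
  simp only [linForm, mk_re, mk_im, hP]
  field_simp

/-- A linear combination of two points of the hyperboloid which lies on the hyperboloid. -/
lemma exists_linForm_combination (z w : ℍ) {α β : ℝ} (hα : 0 ≤ α) (hβ : 0 ≤ β)
    (h : α ^ 2 + β ^ 2 + 2 * α * β * Real.cosh (dist z w) = 1) :
    ∃ u : ℍ, ∀ A B C, linForm A B C u = α * linForm A B C z + β * linForm A B C w := by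
  have hz := z.im_pos
  have hw := w.im_pos
  have hne : 0 < α ∨ 0 < β := by
    by_contra! hc
    have h1 : α = 0 := le_antisymm hc.1 hα
    have h2 : β = 0 := le_antisymm hc.2 hβ
    simp [h1, h2] at h
  rw [cosh_dist_eq] at h
  obtain ⟨u, hu⟩ := exists_linForm_eq
    (P := α * ((z.re ^ 2 + z.im ^ 2) / z.im) + β * ((w.re ^ 2 + w.im ^ 2) / w.im))
    (Q := α * (z.re / z.im) + β * (w.re / w.im)) (R := α / z.im + β / w.im)
    (by rcases hne with h | h <;> positivity)
    (by rw [← h]; field_simp; ring)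
  refine ⟨u, fun A B C => ?_⟩
  rw [hu]; simp only [linForm]; field_simp; ring

lemma cosh_dist_combination {z w u : ℍ} {α β : ℝ}
    (hu : ∀ A B C, linForm A B C u = α * linForm A B C z + β * linForm A B C w) (v : ℍ) :
    Real.cosh (dist v u) = α * Real.cosh (dist v z) + β * Real.cosh (dist v w) := by
  simp only [cosh_dist_eq_linForm v, hu]

/-- Geodesic segments in hyperboloid coordinates. -/
lemma linForm_of_mem_hypSegment {z w u : ℍ} (hu : u ∈ hypSegment z w) (A B C : ℝ) :
    Real.sinh (dist z w) * linForm A B C u =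
      Real.sinh (dist u w) * linForm A B C z + Real.sinh (dist z u) * linForm A B C w := by
  have hu' : dist z u + dist u w = dist z w := hu
  set s := dist z u
  set t := dist u w
  have hz := z.im_pos
  have hw := w.im_pos
  have hu0 := u.im_pos
  -- `(P, Q, R)` is the defect of the claimed identity, and `key` computes its Minkowski pairing
  -- with a point `v`. It is orthogonal to `z`, `w` and `u`, hence to itself; an isotropic vector
  -- orthogonal to the timelike vector `u` is zero.
  obtain ⟨P, hP⟩ : ∃ P, P = Real.sinh (s + t) * ((u.re ^ 2 + u.im ^ 2) / u.im)
    - Real.sinh t * ((z.re ^ 2 + z.im ^ 2) / z.im)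
    - Real.sinh s * ((w.re ^ 2 + w.im ^ 2) / w.im) := ⟨_, rfl⟩
  obtain ⟨Q, hQ⟩ : ∃ Q, Q = Real.sinh (s + t) * (u.re / u.im) - Real.sinh t * (z.re / z.im)
    - Real.sinh s * (w.re / w.im) := ⟨_, rfl⟩
  obtain ⟨R, hR⟩ : ∃ R, R = Real.sinh (s + t) / u.im - Real.sinh t / z.im
    - Real.sinh s / w.im := ⟨_, rfl⟩
  have key : ∀ v : ℍ, P / v.im + R * ((v.re ^ 2 + v.im ^ 2) / v.im) - 2 * Q * (v.re / v.im)
      = 2 * (Real.sinh (s + t) * Real.cosh (dist u v) - Real.sinh t * Real.cosh (dist z v)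
        - Real.sinh s * Real.cosh (dist w v)) := by
    intro v
    have hv := v.im_pos
    simp only [cosh_dist_eq, hP, hQ, hR]
    field_simp
    ring
  have hzu : dist z u = s := rfl
  have huw : dist u w = t := rfl
  clear_value s t
  have kz := key z
  have kw := key w
  have ku := key u
  rw [dist_comm u z, dist_comm w z, dist_self, Real.cosh_zero, ← hu', hzu] at kz
  rw [dist_self, Real.cosh_zero, ← hu', huw] at kw
  rw [dist_self, Real.cosh_zero, dist_comm w u, hzu, huw] at ku
  have ez : Real.sinh (s + t) * Real.cosh s - Real.sinh t * 1
      - Real.sinh s * Real.cosh (s + t) = 0 := by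
    rw [Real.sinh_add, Real.cosh_add]; linear_combination Real.sinh t * Real.cosh_sq s
  have ew : Real.sinh (s + t) * Real.cosh t - Real.sinh t * Real.cosh (s + t)
      - Real.sinh s * 1 = 0 := by
    rw [Real.sinh_add, Real.cosh_add]; linear_combination Real.sinh s * Real.cosh_sq t
  have eu : Real.sinh (s + t) * 1 - Real.sinh t * Real.cosh s
      - Real.sinh s * Real.cosh t = 0 := by
    rw [Real.sinh_add]; ring
  rw [ez] at kz; rw [ew] at kw; rw [eu] at ku
  have hPR : P * R = Q ^ 2 := by
    linear_combination (P * hR + R * hP - 2 * Q * hQ + Real.sinh (s + t) * ku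
      - Real.sinh t * kz - Real.sinh s * kw) / 2
  have ku' : P + R * (u.re ^ 2 + u.im ^ 2) = 2 * Q * u.re := by
    field_simp at ku; linarith
  have hsum : (Q - R * u.re) ^ 2 + (R * u.im) ^ 2 = 0 := by
    linear_combination -hPR + R * ku'
  have hR0 : R = 0 := by
    have : (R * u.im) ^ 2 = 0 :=
      le_antisymm (by linarith [sq_nonneg (Q - R * u.re)]) (sq_nonneg _)
    exact (mul_eq_zero.1 (pow_eq_zero_iff two_ne_zero |>.1 this)).resolve_right hu0.ne'
  have hQ0 : Q = 0 := by
    rw [hR0] at hsum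
    exact pow_eq_zero_iff two_ne_zero |>.1 (by linear_combination hsum)
  have hP0 : P = 0 := by
    rw [hR0, hQ0] at ku'; linarith
  rw [hP0] at hP; rw [hQ0] at hQ; rw [hR0] at hR
  rw [← hu']
  simp only [linForm]
  linear_combination -A * hP - B * hQ - C * hR

/-- Balls are convex because `cosh (dist c ·)` is a linear form and, by `sinh s + sinh t ≤ sinh (s +
t)`, its endpoint weights along a segment sum to at most one. -/
lemma cosh_dist_le_of_mem_hypSegment {c z w u : ℍ} {r : ℝ} (hu : u ∈ hypSegment z w)
    (hz : dist c z ≤ r) (hw : dist c w ≤ r) : dist c u ≤ r := by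
  have hu' : dist z u + dist u w = dist z w := hu
  have hr : 0 ≤ r := dist_nonneg.trans hz
  rcases (dist_nonneg (x := z) (y := w)).eq_or_lt with h0 | hpos
  · have : dist z u = 0 := by
      linarith [dist_nonneg (x := z) (y := u), dist_nonneg (x := u) (y := w)]
    rwa [← dist_eq_zero.1 this]
  have hS : 0 < Real.sinh (dist z w) := Real.sinh_pos_iff.2 hpos
  have hs : 0 ≤ Real.sinh (dist z u) := Real.sinh_nonneg_iff.2 dist_nonneg
  have ht : 0 ≤ Real.sinh (dist u w) := Real.sinh_nonneg_iff.2 dist_nonneg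
  have hadd : Real.sinh (dist z u) + Real.sinh (dist u w) ≤ Real.sinh (dist z w) := by
    rw [← hu', Real.sinh_add]
    nlinarith [Real.one_le_cosh (dist z u), Real.one_le_cosh (dist u w)]
  have key := linForm_of_mem_hypSegment hu (1 / (2 * c.im)) (-(c.re / c.im))
    ((c.re ^ 2 + c.im ^ 2) / (2 * c.im))
  simp only [← cosh_dist_eq_linForm] at key
  have hz' : Real.cosh (dist c z) ≤ Real.cosh r :=
    Real.cosh_le_cosh.2 (by rwa [abs_of_nonneg dist_nonneg, abs_of_nonneg hr])
  have hw' : Real.cosh (dist c w) ≤ Real.cosh r :=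
    Real.cosh_le_cosh.2 (by rwa [abs_of_nonneg dist_nonneg, abs_of_nonneg hr])
  have : Real.cosh (dist c u) ≤ Real.cosh r := by
    refine le_of_mul_le_mul_left ?_ hS
    rw [key]
    nlinarith [mul_le_mul_of_nonneg_left hz' ht, mul_le_mul_of_nonneg_left hw' hs,
      mul_le_mul_of_nonneg_right hadd (Real.cosh_pos r).le]
  rwa [Real.cosh_le_cosh, abs_of_nonneg dist_nonneg, abs_of_nonneg hr] at this

lemma exists_mem_hypSegment {z w : ℍ} (hne : z ≠ w) {s : ℝ} (h0 : 0 ≤ s) (hs : s ≤ dist z w) :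
    ∃ u ∈ hypSegment z w, ∀ A B C, Real.sinh (dist z w) * linForm A B C u =
      Real.sinh (dist z w - s) * linForm A B C z + Real.sinh s * linForm A B C w := by
  have hpos : 0 < dist z w := dist_pos.2 hne
  have hS : 0 < Real.sinh (dist z w) := Real.sinh_pos_iff.2 hpos
  set t := dist z w - s with ht
  have hst : dist z w = s + t := by rw [ht]; ring
  have ht0 : 0 ≤ t := by linarith
  have hsn : 0 ≤ Real.sinh s := Real.sinh_nonneg_iff.2 h0
  have htn : 0 ≤ Real.sinh t := Real.sinh_nonneg_iff.2 ht0
  obtain ⟨u, hu⟩ := exists_linForm_combination z w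
    (α := Real.sinh t / Real.sinh (dist z w)) (β := Real.sinh s / Real.sinh (dist z w))
    (by positivity) (by positivity) (by
      field_simp
      rw [hst, Real.sinh_add, Real.cosh_add]
      have h1 := Real.cosh_sq s
      have h2 := Real.cosh_sq t
      linear_combination (-Real.sinh t ^ 2) * h1 + (-Real.sinh s ^ 2) * h2)
  have hzu : dist z u = s := by
    have h := cosh_dist_combination hu z
    rw [dist_self, Real.cosh_zero] at h
    have : Real.cosh (dist z u) = Real.cosh s := by
      rw [h]; field_simp
      rw [hst, Real.sinh_add, Real.cosh_add]
      linear_combination (-Real.sinh t) * Real.cosh_sq s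
    have := Real.cosh_abs (dist z u) ▸ this
    exact (Real.cosh_strictMonoOn.injOn (by simp) (by simpa using h0) (by simpa using this))
  have hwu : dist u w = t := by
    have h := cosh_dist_combination hu w
    rw [dist_self, Real.cosh_zero, dist_comm w z] at h
    have : Real.cosh (dist u w) = Real.cosh t := by
      rw [dist_comm, h]; field_simp
      rw [hst, Real.sinh_add, Real.cosh_add]
      linear_combination (-Real.sinh s) * Real.cosh_sq t
    exact (Real.cosh_strictMonoOn.injOn (by simp) (by simpa using ht0) (by simpa using this))
  refine ⟨u, show _ = _ by rw [hzu, hwu, hst], fun A B C => ?_⟩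
  rw [hu]; field_simp

/-! ### Hyperbolic distance and slopes seen from a point of the axis -/

lemma dist_sq_ofReal (x : ℝ) (z : ℍ) : dist (x : ℂ) z ^ 2 = (z.re - x) ^ 2 + z.im ^ 2 := by
  rw [dist_comm, Complex.dist_eq, Complex.sq_norm, Complex.normSq_apply]
  simp; ring

lemma sqrt_one_add_slope_sq (x : ℝ) (z : ℍ) :
    √(1 + slope x z ^ 2) = dist (x : ℂ) z / z.im := by
  have := z.im_pos
  rw [Real.sqrt_eq_iff_eq_sq (by positivity) (by positivity), div_pow, dist_sq_ofReal, slope]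
  field_simp; ring

/-- Distance splits into the difference of signed distances to the vertical at `x` and a nonnegative
error measuring the failure of `z` and `w` to lie on one circle about `x`. -/
lemma cosh_dist_eq_cosh_sub_add (x : ℝ) (z w : ℍ) : Real.cosh (dist z w) =
    Real.cosh (Real.arsinh (slope x z) - Real.arsinh (slope x w)) +
      (dist (x : ℂ) z - dist (x : ℂ) w) ^ 2 / (2 * z.im * w.im) := by
  have := z.im_pos
  have := w.im_pos
  have hz := dist_sq_ofReal x z
  have hw := dist_sq_ofReal x w
  rw [Real.cosh_sub, Real.cosh_arsinh, Real.cosh_arsinh, Real.sinh_arsinh, Real.sinh_arsinh,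
    sqrt_one_add_slope_sq, sqrt_one_add_slope_sq, cosh_dist_eq, slope, slope]
  field_simp
  linear_combination -hz - hw

lemma abs_arsinh_slope_sub_le (x : ℝ) (z w : ℍ) :
    |Real.arsinh (slope x z) - Real.arsinh (slope x w)| ≤ dist z w := by
  rw [← abs_of_nonneg (dist_nonneg (x := z) (y := w)), ← Real.cosh_le_cosh,
    cosh_dist_eq_cosh_sub_add x z w]
  have := z.im_pos
  have := w.im_pos
  linarith [show 0 ≤ (dist (x : ℂ) z - dist (x : ℂ) w) ^ 2 / (2 * z.im * w.im) by positivity]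

lemma dist_eq_abs_arsinh_slope_sub {x : ℝ} {z w : ℍ} (h : dist (x : ℂ) z = dist (x : ℂ) w) :
    dist z w = |Real.arsinh (slope x z) - Real.arsinh (slope x w)| := by
  have key := cosh_dist_eq_cosh_sub_add x z w
  rw [h, sub_self, ← Real.cosh_abs (_ - _)] at key
  exact Real.cosh_strictMonoOn.injOn (by simp) (by simp) (by simpa using key)

end UpperHalfPlane

/-! ### Euclidean convex sets and an envelope theorem -/

lemma lt_of_mem_interior_of_linear_le {S : Set ℂ} {α β c : ℝ} (h0 : α ≠ 0 ∨ β ≠ 0)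
    (hle : ∀ z ∈ S, α * z.re + β * z.im ≤ c) {z : ℂ} (hz : z ∈ interior S) :
    α * z.re + β * z.im < c := by
  have hcont : Tendsto (fun t : ℝ => z + t * (⟨α, β⟩ : ℂ)) (𝓝[>] 0) (𝓝 z) := by
    have : ContinuousAt (fun t : ℝ => z + t * (⟨α, β⟩ : ℂ)) 0 := by fun_prop
    have h := this.tendsto
    simp only [Complex.ofReal_zero, zero_mul, add_zero] at h
    exact h.mono_left nhdsWithin_le_nhds
  obtain ⟨t, htS, ht⟩ := ((hcont.eventually (isOpen_interior.mem_nhds hz)).and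
    self_mem_nhdsWithin).exists
  have ht0 : (0 : ℝ) < t := ht
  have h := hle _ (interior_subset htS)
  simp only [Complex.add_re, Complex.mul_re, Complex.ofReal_re, Complex.ofReal_im, zero_mul,
    sub_zero, Complex.add_im, Complex.mul_im, add_zero] at h
  have hpos : 0 < t * (α ^ 2 + β ^ 2) := by
    refine mul_pos ht0 ?_
    rcases h0 with h0 | h0 <;> positivity
  nlinarith

lemma StrictConvex.eq_of_linear_max {S : Set ℂ} (hS : StrictConvex ℝ S) {α β c : ℝ}
    (h0 : α ≠ 0 ∨ β ≠ 0) (hle : ∀ z ∈ S, α * z.re + β * z.im ≤ c) {p q : ℂ} (hp : p ∈ S)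
    (hq : q ∈ S) (hpc : c ≤ α * p.re + β * p.im) (hqc : c ≤ α * q.re + β * q.im) : p = q := by
  by_contra hne
  have hmid := hS hp hq hne (a := 1 / 2) (b := 1 / 2) (by norm_num) (by norm_num) (by norm_num)
  have h := lt_of_mem_interior_of_linear_le h0 hle hmid
  simp at h
  linarith

/-- The horizontal chord of `S` through a point has both its ends on the frontier. -/
lemma IsCompact.convexHull_frontier {S : Set ℂ} (hS : IsCompact S) (hconv : Convex ℝ S) :
    convexHull ℝ (frontier S) = S := by
  refine (convexHull_min hS.isClosed.frontier_subset hconv).antisymm fun z hz => ?_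
  have hT : IsCompact (S ∩ {w | w.im = z.im}) :=
    hS.inter_right (isClosed_eq Complex.continuous_im continuous_const)
  have hex : ∀ ε : ℝ, ε ≠ 0 → ∃ w ∈ frontier S, w.im = z.im ∧ ε * z.re ≤ ε * w.re := by
    intro ε hε
    obtain ⟨w, ⟨hwS, hwim⟩, hw⟩ := hT.exists_isMaxOn ⟨z, hz, rfl⟩
      (f := fun w : ℂ => ε * w.re) (by fun_prop)
    refine ⟨w, ?_, hwim, hw ⟨hz, rfl⟩⟩
    rw [hS.isClosed.frontier_eq]
    refine ⟨hwS, fun hint => ?_⟩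
    have hcont : Tendsto (fun t : ℝ => w + ((t * ε : ℝ) : ℂ)) (𝓝[>] 0) (𝓝 w) := by
      have : ContinuousAt (fun t : ℝ => w + ((t * ε : ℝ) : ℂ)) 0 := by fun_prop
      have h := this.tendsto
      simp only [Complex.ofReal_zero, zero_mul, add_zero] at h
      exact h.mono_left nhdsWithin_le_nhds
    obtain ⟨t, htS, ht⟩ := ((hcont.eventually (isOpen_interior.mem_nhds hint)).and
      self_mem_nhdsWithin).exists
    have ht0 : (0 : ℝ) < t := ht
    have h := hw ⟨interior_subset htS, by
      simp only [Set.mem_ofPred_eq, Complex.add_im, Complex.ofReal_im, add_zero]; exact hwim⟩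
    simp only [Set.mem_ofPred_eq, Complex.add_re, Complex.ofReal_re] at h
    have : 0 < t * ε ^ 2 := by positivity
    nlinarith
  obtain ⟨w₁, hw₁, him₁, hre₁⟩ := hex 1 one_ne_zero
  obtain ⟨w₂, hw₂, him₂, hre₂⟩ := hex (-1) (by norm_num)
  rw [one_mul, one_mul] at hre₁
  have hre₂' : w₂.re ≤ z.re := by linarith
  refine (convex_convexHull ℝ _).segment_subset (subset_convexHull ℝ _ hw₂)
    (subset_convexHull ℝ _ hw₁) ?_
  rcases hre₁.eq_or_lt with h | h
  · rw [show z = w₁ from Complex.ext h him₁.symm]; exact right_mem_segment _ _ _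
  · have hd : 0 < w₁.re - w₂.re := by linarith
    refine ⟨(w₁.re - z.re) / (w₁.re - w₂.re), (z.re - w₂.re) / (w₁.re - w₂.re),
      div_nonneg (by linarith) hd.le, div_nonneg (by linarith) hd.le, by field_simp; ring, ?_⟩
    apply Complex.ext
    · simp only [Complex.add_re, Complex.smul_re, smul_eq_mul]
      field_simp; ring
    · simp only [Complex.add_im, Complex.smul_im, smul_eq_mul, him₁, him₂]
      field_simp; ring

/-- Envelope theorem for a family of functions depending affinely on the parameter, with unique
maximizers. -/
lemma IsCompact.hasDerivAt_max {X : Type*} [TopologicalSpace X] {K : Set X}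
    (hK : IsCompact K) {a b : X → ℝ} (ha : Continuous a) (hb : Continuous b) {p : ℝ → X}
    (hp : ∀ x, p x ∈ K) (hmax : ∀ x, ∀ z ∈ K, a z + x * b z ≤ a (p x) + x * b (p x))
    (huniq : ∀ x, ∀ z ∈ K, (∀ w ∈ K, a w + x * b w ≤ a z + x * b z) → z = p x) (x : ℝ) :
    HasDerivAt (fun y => a (p y) + y * b (p y)) (b (p x)) x := by
  -- Compactness and uniqueness of the maximizer make `p` continuous.
  have hcont : Tendsto p (𝓝 x) (𝓝 (p x)) := by
    refine hK.tendsto_nhds_of_unique_mapClusterPt (Eventually.of_forall hp) fun z hz hclus => ?_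
    obtain ⟨U, hU, hUz⟩ := mapClusterPt_iff_ultrafilter.1 hclus
    refine huniq x z hz fun w hw => ?_
    have hid : Tendsto (fun y : ℝ => y) U (𝓝 x) := hU
    exact le_of_tendsto_of_tendsto' (tendsto_const_nhds.add (hid.mul_const _))
      (((ha.tendsto z).comp hUz).add (hid.mul ((hb.tendsto z).comp hUz))) fun y => hmax y w hw
  rw [hasDerivAt_iff_isLittleO, Asymptotics.isLittleO_iff]
  intro c hc
  have hbp : Tendsto (fun y => b (p y)) (𝓝 x) (𝓝 (b (p x))) := (hb.tendsto _).comp hcont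
  filter_upwards [hbp.eventually (Metric.ball_mem_nhds _ hc)] with y hy
  have hy' : |b (p y) - b (p x)| < c := hy
  have h1 := hmax y (p x) (hp x)
  have h2 := hmax x (p y) (hp y)
  rw [smul_eq_mul, Real.norm_eq_abs, Real.norm_eq_abs]
  -- Optimality at `x` and at `y` squeezes the error `D` between `0` and `(y - x) * (b (p y) - b (p
  -- x))`, which is `o(y - x)`.
  set D := a (p y) + y * b (p y) - (a (p x) + x * b (p x)) - (y - x) * b (p x) with hD
  have hD0 : 0 ≤ D := by rw [hD]; linarith
  have hD1 : D ≤ (y - x) * (b (p y) - b (p x)) := by rw [hD]; linarith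
  rw [abs_of_nonneg hD0]
  calc D ≤ |(y - x) * (b (p y) - b (p x))| := hD1.trans (le_abs_self _)
    _ = |b (p y) - b (p x)| * |y - x| := by rw [abs_mul, mul_comm]
    _ ≤ c * |y - x| := by gcongr

/-! ### Contact points of tangent segments as extremizers of the slope -/

namespace UpperHalfPlane

lemma slope_le_iff {x s : ℝ} {z : ℍ} : slope x z ≤ s ↔ z.re - s * z.im ≤ x := by
  rw [slope, div_le_iff₀ z.im_pos]; constructor <;> intro h <;> linarith

lemma le_slope_iff {x s : ℝ} {z : ℍ} : s ≤ slope x z ↔ x ≤ z.re - s * z.im := by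
  rw [slope, le_div_iff₀ z.im_pos]; constructor <;> intro h <;> linarith

variable {K : Set ℍ} {x : ℝ} {p q : ℍ}

lemma linear_max_of_isMaxOn_slope (hmax : IsMaxOn (slope x) K p) :
    ∀ z ∈ ((↑) '' K : Set ℂ), 1 * z.re + -(slope x p) * z.im ≤ x := by
  rintro _ ⟨z, hz, rfl⟩
  have : slope x z ≤ slope x p := hmax hz
  have := slope_le_iff.1 this
  simp only [coe_re, coe_im]; linarith

lemma linear_max_of_isMinOn_slope (hmin : IsMinOn (slope x) K p) :
    ∀ z ∈ ((↑) '' K : Set ℂ), -1 * z.re + slope x p * z.im ≤ -x := by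
  rintro _ ⟨z, hz, rfl⟩
  have : slope x p ≤ slope x z := hmin hz
  have := le_slope_iff.1 this
  simp only [coe_re, coe_im]; linarith

lemma eq_of_isMaxOn_slope (hS : StrictConvex ℝ ((↑) '' K : Set ℂ)) (hp : p ∈ K) (hq : q ∈ K)
    (hmp : IsMaxOn (slope x) K p) (hmq : IsMaxOn (slope x) K q) : p = q := by
  have h1 := le_slope_iff.1 (le_refl (slope x p))
  have h2 := le_slope_iff.1 (hmq hp : slope x p ≤ slope x q)
  exact coe_inj.1 (hS.eq_of_linear_max (Or.inl one_ne_zero) (linear_max_of_isMaxOn_slope hmp)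
    ⟨p, hp, rfl⟩ ⟨q, hq, rfl⟩ (by simp only [coe_re, coe_im]; linarith)
    (by simp only [coe_re, coe_im]; linarith))

lemma eq_of_isMinOn_slope (hS : StrictConvex ℝ ((↑) '' K : Set ℂ)) (hp : p ∈ K) (hq : q ∈ K)
    (hmp : IsMinOn (slope x) K p) (hmq : IsMinOn (slope x) K q) : p = q := by
  have h1 := slope_le_iff.1 (le_refl (slope x p))
  have h2 := slope_le_iff.1 (hmq hp : slope x q ≤ slope x p)
  exact coe_inj.1 (hS.eq_of_linear_max (Or.inl (by norm_num)) (linear_max_of_isMinOn_slope hmp)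
    ⟨p, hp, rfl⟩ ⟨q, hq, rfl⟩ (by simp only [coe_re, coe_im]; linarith)
    (by simp only [coe_re, coe_im]; linarith))

lemma eq_of_isMaxOn_im (hS : StrictConvex ℝ ((↑) '' K : Set ℂ)) (hp : p ∈ K) (hq : q ∈ K)
    (hmp : IsMaxOn im K p) (hmq : IsMaxOn im K q) : p = q := by
  refine coe_inj.1 (hS.eq_of_linear_max (α := 0) (β := 1) (c := p.im) (Or.inr one_ne_zero) ?_
    ⟨p, hp, rfl⟩ ⟨q, hq, rfl⟩ (by simp) (by simpa using hmq hp))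
  rintro _ ⟨z, hz, rfl⟩
  simpa using hmp hz

lemma eq_of_isMinOn_im (hS : StrictConvex ℝ ((↑) '' K : Set ℂ)) (hp : p ∈ K) (hq : q ∈ K)
    (hmp : IsMinOn im K p) (hmq : IsMinOn im K q) : p = q := by
  refine coe_inj.1 (hS.eq_of_linear_max (α := 0) (β := -1) (c := -p.im) (Or.inr (by norm_num)) ?_
    ⟨p, hp, rfl⟩ ⟨q, hq, rfl⟩ (by simp) (by simpa using hmq hp))
  rintro _ ⟨z, hz, rfl⟩
  simpa using hmp hz

lemma det_eq (x : ℝ) (z p : ℂ) : ((z - x) * conj (p - x)).im =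
    z.im * (p.re - x) - (z.re - x) * p.im := by
  simp [Complex.mul_im]; ring

lemma slope_le_slope_iff {x : ℝ} {z p : ℍ} :
    slope x z ≤ slope x p ↔ 0 ≤ ((z - x : ℂ) * conj (p - x : ℂ)).im := by
  rw [det_eq, slope, slope, div_le_div_iff₀ z.im_pos p.im_pos]
  simp only [coe_re, coe_im]
  constructor <;> intro h <;> linarith

lemma forall_mem_of_forall_mem_frontier (hc : IsCompact K)
    (hS : StrictConvex ℝ ((↑) '' K : Set ℂ)) {f : ℂ →ᵃ[ℝ] ℝ}
    (h : ∀ z ∈ frontier ((↑) '' K : Set ℂ), 0 ≤ f z) : ∀ z ∈ K, 0 ≤ f z := by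
  have hsub : convexHull ℝ (frontier ((↑) '' K : Set ℂ)) ⊆ f ⁻¹' Set.Ici 0 :=
    convexHull_min h ((convex_Ici 0).affine_preimage f)
  rw [(hc.image continuous_coe).convexHull_frontier hS.convex] at hsub
  exact fun z hz => hsub ⟨z, hz, rfl⟩

lemma isTangentSegment_iff (hc : IsCompact K) (hS : StrictConvex ℝ ((↑) '' K : Set ℂ))
    (x : ℝ) (p : ℂ) : IsTangentSegment (frontier ((↑) '' K : Set ℂ)) x p ↔
      ∃ P ∈ K, (P : ℂ) = p ∧ (IsMaxOn (slope x) K P ∨ IsMinOn (slope x) K P) := by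
  have hcl : IsClosed ((↑) '' K : Set ℂ) := (hc.image continuous_coe).isClosed
  let f : ℂ → ℂ →ᵃ[ℝ] ℝ := fun p =>
    ((p.re - x) • Complex.imLm - p.im • Complex.reLm).toAffineMap +
      AffineMap.const ℝ ℂ (x * p.im)
  have hf : ∀ p z, f p z = ((z - x) * conj (p - x)).im := fun p z => by
    rw [det_eq]; simp [f]; ring
  constructor
  · rintro ⟨hp, -, h⟩
    obtain ⟨P, hP, rfl⟩ := hcl.frontier_subset hp
    refine ⟨P, hP, rfl, h.imp (fun h => ?_) fun h => ?_⟩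
    · intro z hz
      refine slope_le_slope_iff.2 ?_
      rw [← hf]
      exact forall_mem_of_forall_mem_frontier hc hS (fun w hw => by rw [hf]; exact h w hw) z hz
    · intro z hz
      have := forall_mem_of_forall_mem_frontier hc hS (f := -f P)
        (fun w hw => by
          have := h w hw
          rw [← hf] at this
          simpa using this) z hz
      have h' : f P z ≤ 0 := by simpa using this
      refine slope_le_slope_iff.2 ?_
      rw [hf, det_eq] at h'
      rw [det_eq]; linarith
  · rintro ⟨P, hP, rfl, h⟩
    refine ⟨?_, ne_ofReal P x, h.imp (fun h z hz => ?_) fun h z hz => ?_⟩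
    · rw [hcl.frontier_eq]
      refine ⟨⟨P, hP, rfl⟩, fun hint => ?_⟩
      rcases h with h | h
      · have h1 := lt_of_mem_interior_of_linear_le (Or.inl one_ne_zero)
          (linear_max_of_isMaxOn_slope h) hint
        have h2 := le_slope_iff.1 (le_refl (slope x P))
        simp only [coe_re, coe_im] at h1; linarith
      · have h1 := lt_of_mem_interior_of_linear_le (Or.inl (by norm_num))
          (linear_max_of_isMinOn_slope h) hint
        have h2 := slope_le_iff.1 (le_refl (slope x P))
        simp only [coe_re, coe_im] at h1; linarith
    · obtain ⟨Z, hZ, rfl⟩ := hcl.frontier_subset hz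
      exact slope_le_slope_iff.1 (h hZ)
    · obtain ⟨Z, hZ, rfl⟩ := hcl.frontier_subset hz
      have := slope_le_slope_iff.1 (h hZ)
      rw [det_eq] at this ⊢; linarith

lemma equalTangentSegments_iff (hc : IsCompact K) (hS : StrictConvex ℝ ((↑) '' K : Set ℂ))
    (x : ℝ) : EqualTangentSegments (frontier ((↑) '' K : Set ℂ)) x ↔
      ∀ p ∈ K, ∀ q ∈ K, IsMaxOn (slope x) K p → IsMinOn (slope x) K q →
        dist (x : ℂ) p = dist (x : ℂ) q := by
  simp only [EqualTangentSegments, isTangentSegment_iff hc hS]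
  constructor
  · exact fun h p hp q hq hmp hmq => h p q ⟨p, hp, rfl, Or.inl hmp⟩ ⟨q, hq, rfl, Or.inr hmq⟩
  · rintro h _ _ ⟨p, hp, rfl, hmp⟩ ⟨q, hq, rfl, hmq⟩
    rcases hmp with hmp | hmp <;> rcases hmq with hmq | hmq
    · rw [eq_of_isMaxOn_slope hS hp hq hmp hmq]
    · exact h p hp q hq hmp hmq
    · exact (h q hq p hp hmq hmp).symm
    · rw [eq_of_isMinOn_slope hS hp hq hmp hmq]

end UpperHalfPlane

/-! ### Geodesics as zero sets of spacelike linear forms -/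

namespace HypLine

open UpperHalfPlane

lemma side_vertical_eq (a : ℝ) (z : ℍ) : (vertical a).side z = z.im * linForm 0 1 (-a) z := by
  have := z.im_pos
  simp only [side, linForm]; field_simp; ring

lemma exists_pos_side_semicircle_eq (c r : ℝ) (hr : 0 < r) (z : ℍ) : ∃ m : ℝ, 0 < m ∧
    (semicircle c r hr).side z = m * linForm 1 (-2 * c) (c ^ 2 - r ^ 2) z := by
  have hz := z.im_pos
  have hd := dist_sq_ofReal c z
  rw [dist_comm] at hd
  have h0 : 0 ≤ dist (z : ℂ) c := dist_nonneg
  refine ⟨z.im / (dist (z : ℂ) c + r), by positivity, ?_⟩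
  simp only [side, linForm]
  field_simp
  linear_combination hd

/-- A geodesic is the zero set of a spacelike linear form, positive multiples of which give the
side function. -/
lemma exists_pos_side_eq (L : HypLine) : ∃ A B C : ℝ, 0 < B ^ 2 - 4 * A * C ∧
    ∀ z, ∃ m : ℝ, 0 < m ∧ L.side z = m * linForm A B C z := by
  cases L with
  | vertical a => exact ⟨0, 1, -a, by norm_num, fun z => ⟨z.im, z.im_pos, side_vertical_eq a z⟩⟩
  | semicircle c r hr =>
    exact ⟨1, -2 * c, c ^ 2 - r ^ 2, by nlinarith [sq_nonneg c],
      exists_pos_side_semicircle_eq c r hr⟩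

lemma linForm_smul (k A B C : ℝ) (z : ℍ) :
    linForm (k * A) (k * B) (k * C) z = k * linForm A B C z := by
  simp only [linForm]; ring

lemma exists_linForm_of_supports {L : HypLine} {K : Set ℍ} (h : L.Supports K) :
    ∃ A B C : ℝ, 0 < B ^ 2 - 4 * A * C ∧ L.points = {z | linForm A B C z = 0} ∧
      ∀ z ∈ K, linForm A B C z ≤ 0 := by
  obtain ⟨A, B, C, hD, hm⟩ := L.exists_pos_side_eq
  have hpts : ∀ k : ℝ, k ≠ 0 →
      L.points = {z | linForm (k * A) (k * B) (k * C) z = 0} := by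
    intro k hk
    ext z
    obtain ⟨m, hm0, hmz⟩ := hm z
    simp [points, linForm_smul, hmz, hm0.ne', hk]
  rcases h.2 with h | h
  · refine ⟨-1 * A, -1 * B, -1 * C, by linarith, hpts _ (by norm_num), fun z hz => ?_⟩
    obtain ⟨m, hm0, hmz⟩ := hm z
    have := h z hz
    rw [hmz] at this
    rw [linForm_smul]
    linarith [nonneg_of_mul_nonneg_right this hm0]
  · refine ⟨1 * A, 1 * B, 1 * C, by linarith, hpts _ (by norm_num), fun z hz => ?_⟩
    obtain ⟨m, hm0, hmz⟩ := hm z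
    have := h z hz
    rw [hmz] at this
    rw [linForm_smul]
    nlinarith

/-- The zero set of a spacelike linear form is a geodesic. -/
lemma exists_side_eq {A B C : ℝ} (hD : 0 < B ^ 2 - 4 * A * C) :
    ∃ (L : HypLine) (k : ℝ), k ≠ 0 ∧
      ∀ z, ∃ m : ℝ, 0 < m ∧ L.side z = m * (k * linForm A B C z) := by
  by_cases hA : A = 0
  · subst hA
    have hB : B ≠ 0 := by rintro rfl; simp at hD
    refine ⟨vertical (-C / B), B⁻¹, inv_ne_zero hB, fun z => ⟨z.im, z.im_pos, ?_⟩⟩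
    rw [side_vertical_eq, ← linForm_smul B⁻¹]
    congr 2 <;> field_simp
    simp
  · have hr : 0 < √(B ^ 2 - 4 * A * C) / (2 * |A|) := by
      have := Real.sqrt_pos.2 hD
      positivity
    refine ⟨semicircle (-B / (2 * A)) _ hr, A⁻¹, inv_ne_zero hA, fun z => ?_⟩
    obtain ⟨m, hm, h⟩ := exists_pos_side_semicircle_eq (-B / (2 * A)) _ hr z
    refine ⟨m, hm, ?_⟩
    rw [h, ← linForm_smul A⁻¹, div_pow _ (2 * |A|), mul_pow, Real.sq_sqrt hD.le, sq_abs]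
    congr 2 <;> field_simp
    ring

lemma exists_supports {A B C : ℝ} (hD : 0 < B ^ 2 - 4 * A * C) {K : Set ℍ} {p : ℍ} (hp : p ∈ K)
    (hp0 : linForm A B C p = 0) (hle : ∀ z ∈ K, linForm A B C z ≤ 0) :
    ∃ L : HypLine, L.points = {z | linForm A B C z = 0} ∧ L.Supports K := by
  obtain ⟨L, k, hk, hL⟩ := exists_side_eq hD
  have hpts : L.points = {z | linForm A B C z = 0} := by
    ext z
    obtain ⟨m, hm0, hmz⟩ := hL z
    simp [points, hmz, hm0.ne', hk]
  refine ⟨L, hpts, ⟨p, by rw [hpts]; exact hp0, hp⟩, ?_⟩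
  rcases lt_or_gt_of_ne hk with hk | hk
  · refine Or.inl fun z hz => ?_
    obtain ⟨m, hm0, hmz⟩ := hL z
    rw [hmz]
    exact mul_nonneg hm0.le (mul_nonneg_of_nonpos_of_nonpos hk.le (hle z hz))
  · refine Or.inr fun z hz => ?_
    obtain ⟨m, hm0, hmz⟩ := hL z
    rw [hmz]
    exact mul_nonpos_of_nonneg_of_nonpos hm0.le (mul_nonpos_of_nonneg_of_nonpos hk.le (hle z hz))

end HypLine

/-! ### Constant width implies equal tangent segments -/

namespace UpperHalfPlane

variable {K : Set ℍ}

lemma infDist_le_hypWidth (hc : IsCompact K) (L : HypLine) {z : ℍ} (hz : z ∈ K) :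
    Metric.infDist z L.points ≤ hypWidth K L :=
  le_csSup (hc.image (Metric.continuous_infDist_pt _)).bddAbove ⟨z, hz, rfl⟩

lemma exists_infDist_eq_hypWidth (hc : IsCompact K) (hne : K.Nonempty) (L : HypLine) :
    ∃ z ∈ K, Metric.infDist z L.points = hypWidth K L :=
  (hc.image (Metric.continuous_infDist_pt _)).sSup_mem (hne.image _)

lemma linForm_sub_mul (A B C A' B' C' k : ℝ) (z : ℍ) : linForm (A - k * A') (B - k * B')
    (C - k * C') z = linForm A B C z - k * linForm A' B' C' z := by
  simp only [linForm]; ring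

lemma cosh_dist_le_cosh {z w z' w' : ℍ} :
    Real.cosh (dist z w) ≤ Real.cosh (dist z' w') ↔ dist z w ≤ dist z' w' := by
  rw [Real.cosh_le_cosh, abs_of_nonneg dist_nonneg, abs_of_nonneg dist_nonneg]

/-- The geodesic through `w` perpendicular to the geodesic from `z` to `w`. -/
lemma exists_linForm_perpendicular {z w : ℍ} (hne : z ≠ w) : ∃ A B C : ℝ,
    0 < B ^ 2 - 4 * A * C ∧ ∀ y, linForm A B C y =
      Real.cosh (dist z y) - Real.cosh (dist z w) * Real.cosh (dist w y) := by
  have hz := z.im_pos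
  have hw := w.im_pos
  have h1 : 1 < Real.cosh (dist z w) := Real.one_lt_cosh.2 (dist_pos.2 hne).ne'
  have hc := cosh_dist_eq z w
  refine ⟨_, _, _, ?_, fun y => by
    rw [cosh_dist_eq_linForm z y, cosh_dist_eq_linForm w y, linForm_sub_mul]⟩
  set c := Real.cosh (dist z w)
  have hc2 : c ^ 2 - 1 = 2 * c * (((z.re - w.re) ^ 2 + z.im ^ 2 + w.im ^ 2)
      / (2 * z.im * w.im)) - 1 - c ^ 2 := by rw [← hc]; ring
  have : 0 < c ^ 2 - 1 := by nlinarith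
  rw [hc2] at this
  convert this using 1
  field_simp
  ring

/-- For a diametral pair `z'`, `w'`, the perpendicular to `z'w'` at `w'` supports `K` and has `w'`
as foot of `z'`, so the diameter is at most the width `d`. -/
lemma dist_le_of_forall_hypWidth_eq (hc : IsCompact K) {d : ℝ}
    (hd : ∀ L : HypLine, L.Supports K → hypWidth K L = d) {z w : ℍ} (hz : z ∈ K) (hw : w ∈ K)
    (hne : z ≠ w) : dist z w ≤ d := by
  obtain ⟨⟨z', w'⟩, ⟨hz', hw'⟩, hmax⟩ := (hc.prod hc).exists_isMaxOn ⟨(z, w), hz, hw⟩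
    (f := fun y : ℍ × ℍ => dist y.1 y.2) continuous_dist.continuousOn
  have hle : ∀ y ∈ K, ∀ y' ∈ K, dist y y' ≤ dist z' w' := fun y hy y' hy' =>
    hmax (show (y, y') ∈ K ×ˢ K from ⟨hy, hy'⟩)
  have hne' : z' ≠ w' := dist_pos.1 ((dist_pos.2 hne).trans_le (hle z hz w hw))
  obtain ⟨A, B, C, hD, hf⟩ := exists_linForm_perpendicular hne'
  obtain ⟨L, hL, hLK⟩ := HypLine.exists_supports hD hw' (by rw [hf]; simp) fun y hy => by
    rw [hf]
    have h1 := cosh_dist_le_cosh.2 (hle z' hz' y hy)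
    have h2 := Real.one_le_cosh (dist w' y)
    nlinarith [Real.cosh_pos (dist z' w')]
  refine (hle z hz w hw).trans (le_trans ?_ ((infDist_le_hypWidth hc L hz').trans_eq (hd L hLK)))
  refine (Metric.le_infDist (hLK.1.mono Set.inter_subset_left)).2 fun y hy => ?_
  rw [hL] at hy
  have hy0 : linForm A B C y = 0 := hy
  rw [hf] at hy0
  refine cosh_dist_le_cosh.1 ?_
  nlinarith [Real.cosh_pos (dist z' w'), Real.one_le_cosh (dist w' y)]

/-- The geodesic through `p` tangent to the straight line through `x` and `p`. -/
lemma exists_linForm_tangent (x : ℝ) (p : ℍ) : ∃ A B C : ℝ, 0 < B ^ 2 - 4 * A * C ∧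
    ∀ y, linForm A B C y = slope x y - slope x p * Real.cosh (dist p y) := by
  have hp := p.im_pos
  refine ⟨_, _, _, ?_, fun y => by
    rw [cosh_dist_eq_linForm p y, slope_eq_linForm x y, linForm_sub_mul]⟩
  have : (0 : ℝ) < 1 + slope x p ^ 2 := by positivity
  convert this using 1
  simp only [slope]
  field_simp
  ring

/-- For a body convex in the hyperbolic metric, the geodesic tangent to a support line supports. -/
lemma slope_le_mul_cosh (hconv : ∀ z ∈ K, ∀ w ∈ K, hypSegment z w ⊆ K) {x : ℝ} {p z : ℍ}
    (hp : p ∈ K) (hmax : IsMaxOn (slope x) K p) (hz : z ∈ K) :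
    slope x z ≤ slope x p * Real.cosh (dist p z) := by
  rcases eq_or_ne p z with rfl | hne
  · simp
  have hpos : 0 < dist p z := dist_pos.2 hne
  have hle : ∀ t, 0 < t → t < dist p z / 2 →
      Real.cosh t * slope x z ≤ slope x p * Real.cosh (dist p z - t) := by
    intro t ht0 ht
    -- Parameter `2 * t` lets sums and differences around `dist p z - t` cancel down to a common
    -- factor `2 * sinh t`; letting `t → 0` then amounts to differentiating at `p`.
    obtain ⟨u, hu, huf⟩ := exists_mem_hypSegment hne (s := 2 * t) (by linarith) (by linarith)
    have hux : slope x u ≤ slope x p := hmax (hconv p hp z hz hu)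
    have h := huf 0 1 (-x)
    simp only [← slope_eq_linForm] at h
    have h1 : Real.sinh (dist p z) = Real.sinh (dist p z - t) * Real.cosh t +
        Real.cosh (dist p z - t) * Real.sinh t := by rw [← Real.sinh_add]; ring_nf
    have h2 : Real.sinh (dist p z - 2 * t) = Real.sinh (dist p z - t) * Real.cosh t -
        Real.cosh (dist p z - t) * Real.sinh t := by rw [← Real.sinh_sub]; ring_nf
    have hS : 0 < Real.sinh (dist p z) := Real.sinh_pos_iff.2 hpos
    have hs : 0 < Real.sinh t := Real.sinh_pos_iff.2 ht0
    have h3 := mul_le_mul_of_nonneg_left hux hS.le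
    rw [h, h2, Real.sinh_two_mul] at h3
    rw [h1] at h3
    refine le_of_mul_le_mul_left ?_ hs
    linarith
  have hlim1 : Tendsto (fun t => Real.cosh t * slope x z) (𝓝[>] 0) (𝓝 (slope x z)) := by
    have : ContinuousAt (fun t => Real.cosh t * slope x z) 0 := by fun_prop
    have h := this.tendsto
    simp only [Real.cosh_zero, one_mul] at h
    exact h.mono_left nhdsWithin_le_nhds
  have hlim2 : Tendsto (fun t => slope x p * Real.cosh (dist p z - t)) (𝓝[>] 0)
      (𝓝 (slope x p * Real.cosh (dist p z))) := by
    have : ContinuousAt (fun t => slope x p * Real.cosh (dist p z - t)) 0 := by fun_prop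
    have h := this.tendsto
    simp only [sub_zero] at h
    exact h.mono_left nhdsWithin_le_nhds
  refine le_of_tendsto_of_tendsto hlim1 hlim2 ?_
  filter_upwards [Ioo_mem_nhdsGT (half_pos hpos)] with t ht using hle t ht.1 ht.2

/-- Points of the geodesic through `p` perpendicular to the circle about `x` through `p`. -/
lemma exists_perpendicular_point (x : ℝ) (p : ℍ) (s : ℝ) : ∃ w : ℍ, ∀ A B C, linForm A B C w =
    Real.cosh s * linForm A B C p + Real.sinh s * ((A * (dist (x : ℂ) p ^ 2 - x ^ 2) - B * x - C) /
      dist (x : ℂ) p) := by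
  have hp := p.im_pos
  have hr := dist_sq_ofReal x p
  set r := dist (x : ℂ) p
  have hr0 : 0 ≤ r := dist_nonneg
  have hpr : p.im ≤ r := by
    refine le_of_sq_le_sq ?_ hr0
    nlinarith [sq_nonneg (p.re - x)]
  have hr1 : 0 < r := hp.trans_le hpr
  obtain ⟨w, hw⟩ := exists_linForm_eq
    (P := Real.cosh s * ((p.re ^ 2 + p.im ^ 2) / p.im) + Real.sinh s * ((r ^ 2 - x ^ 2) / r))
    (Q := Real.cosh s * (p.re / p.im) - Real.sinh s * (x / r))
    (R := Real.cosh s / p.im - Real.sinh s / r)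
    (by
      rw [sub_pos, div_lt_div_iff₀ hr1 hp]
      have := Real.sinh_lt_cosh s
      have := Real.cosh_pos s
      nlinarith)
    (by
      have hs := Real.cosh_sq s
      have hs' : Real.cosh s ^ 2 - Real.sinh s ^ 2 = 1 := by linarith
      rw [← hs']
      field_simp
      linear_combination (Real.cosh s * Real.sinh s * r * p.im) * hr)
  refine ⟨w, fun A B C => ?_⟩
  rw [hw]
  simp only [linForm]
  field_simp
  ring

theorem dist_eq_of_isHypConstantWidthBody (hS : StrictConvex ℝ ((↑) '' K : Set ℂ))
    (hK : IsHypConstantWidthBody K) {x : ℝ} {p q : ℍ} (hp : p ∈ K) (hq : q ∈ K)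
    (hmp : IsMaxOn (slope x) K p) (hmq : IsMinOn (slope x) K q) :
    dist (x : ℂ) p = dist (x : ℂ) q := by
  obtain ⟨⟨hc, -, hconv⟩, d, hd⟩ := hK
  obtain ⟨A, B, C, hD, hf⟩ := exists_linForm_tangent x p
  obtain ⟨L, hL, hLK⟩ := HypLine.exists_supports hD hp (by rw [hf]; simp) fun z hz => by
    rw [hf]
    linarith [slope_le_mul_cosh hconv hp hmp hz]
  have hLne : L.points.Nonempty := hLK.1.mono Set.inter_subset_left
  have hpL : p ∈ L.points := by
    rw [hL]; show linForm A B C p = 0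
    rw [hf]; simp
  obtain ⟨q', hq', hq'd⟩ := exists_infDist_eq_hypWidth hc ⟨p, hp⟩ L
  rw [hd L hLK] at hq'd
  have hd0 : 0 ≤ d := hq'd ▸ Metric.infDist_nonneg
  have hdiam : ∀ z ∈ K, ∀ w ∈ K, dist z w ≤ d := fun z hz w hw => by
    rcases eq_or_ne z w with rfl | hne
    · simpa
    · exact dist_le_of_forall_hypWidth_eq hc hd hz hw hne
  have hpq : dist q' p = d :=
    (hdiam _ hq' _ hp).antisymm (hq'd ▸ Metric.infDist_le_dist_of_mem hpL)
  have hfoot : ∀ w ∈ L.points, dist q' p ≤ dist q' w := fun w hw =>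
    hpq.trans_le (hq'd ▸ Metric.infDist_le_dist_of_mem hw)
  have hr0 : 0 < dist (x : ℂ) p := dist_pos.2 (ne_ofReal p x).symm
  have hr := dist_sq_ofReal x p
  have hq'0 := q'.im_pos
  have hp0 := p.im_pos
  have hxq : dist (x : ℂ) p = dist (x : ℂ) q' := by
    -- `h` is the derivative at `s = 0` of `cosh` of the distance from `q'` to the point of `L` with
    -- parameter `s`. It vanishes because `p` is a nearest point of `L`.
    obtain ⟨h, hh⟩ : ∃ h, h = (dist (x : ℂ) p ^ 2 - dist (x : ℂ) q' ^ 2) /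
      (2 * q'.im * dist (x : ℂ) p) := ⟨_, rfl⟩
    have hmin : IsLocalMin (fun s => Real.cosh s * Real.cosh (dist q' p) + Real.sinh s * h) 0 := by
      refine Eventually.of_forall fun s => ?_
      obtain ⟨w, hw⟩ := exists_perpendicular_point x p s
      have hpw : Real.cosh (dist p w) = Real.cosh s := by
        rw [cosh_dist_eq_linForm, hw, ← cosh_dist_eq_linForm, dist_self, hr]
        simp only [Real.cosh_zero]
        field_simp
        ring
      have hxw : slope x w = Real.cosh s * slope x p := by
        rw [slope_eq_linForm, hw, ← slope_eq_linForm]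
        ring
      have hwL : w ∈ L.points := by
        rw [hL]; show linForm A B C w = 0
        rw [hf, hpw, hxw]; ring
      have h1 := cosh_dist_le_cosh.2 (hfoot w hwL)
      have h2 : Real.cosh (dist q' w) = Real.cosh s * Real.cosh (dist q' p) + Real.sinh s * h := by
        rw [cosh_dist_eq_linForm q' w, hw, ← cosh_dist_eq_linForm, hh, dist_sq_ofReal x q']
        field_simp
        ring
      simpa [← h2] using h1
    have hder : HasDerivAt (fun s => Real.cosh s * Real.cosh (dist q' p) + Real.sinh s * h)
        (Real.sinh 0 * Real.cosh (dist q' p) + Real.cosh 0 * h) 0 :=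
      ((Real.hasDerivAt_cosh 0).mul_const _).add ((Real.hasDerivAt_sinh 0).mul_const _)
    have h0 := hmin.hasDerivAt_eq_zero hder
    simp only [Real.sinh_zero, zero_mul, Real.cosh_zero, one_mul, zero_add] at h0
    rw [hh, div_eq_zero_iff] at h0
    rcases h0 with h0 | h0
    · exact (sq_eq_sq₀ dist_nonneg dist_nonneg).1 (by linarith)
    · exact absurd h0 (by positivity)
  have hmq' : IsMinOn (slope x) K q' := by
    intro z hz
    have h1 := (le_abs_self _).trans ((abs_arsinh_slope_sub_le x p z).trans (hdiam p hp z hz))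
    have h2 := dist_eq_abs_arsinh_slope_sub hxq
    rw [abs_of_nonneg (sub_nonneg.2 (Real.arsinh_le_arsinh.2 (hmp hq'))), dist_comm, hpq] at h2
    exact Real.arsinh_le_arsinh.1 (by linarith)
  rw [hxq, eq_of_isMinOn_slope hS hq hq' hmq hmq']

/-! ### Equal tangent segments imply constant width -/

/-- If the tangent segments from each point of the axis have equal lengths, then the points of
contact are at a constant hyperbolic distance. -/
lemma exists_arsinh_slope_sub_eq (hc : IsCompact K) (hS : StrictConvex ℝ ((↑) '' K : Set ℂ))
    {p q : ℝ → ℍ} (hp : ∀ x, p x ∈ K) (hq : ∀ x, q x ∈ K)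
    (hmp : ∀ x, IsMaxOn (slope x) K (p x)) (hmq : ∀ x, IsMinOn (slope x) K (q x))
    (heq : ∀ x : ℝ, dist (x : ℂ) (p x) = dist (x : ℂ) (q x)) :
    ∃ d, ∀ x, Real.arsinh (slope x (p x)) - Real.arsinh (slope x (q x)) = d := by
  have ha : Continuous fun z : ℍ => z.re / z.im :=
    continuous_re.div continuous_im fun z => z.im_ne_zero
  have hb : Continuous fun z : ℍ => 1 / z.im :=
    continuous_const.div continuous_im fun z => z.im_ne_zero
  have hsl : ∀ x (z : ℍ), slope x z = z.re / z.im + x * -(1 / z.im) := fun x z => by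
    rw [slope]; ring
  have hP : ∀ x, HasDerivAt (fun y => slope y (p y)) (-(1 / (p x).im)) x := by
    intro x
    simp only [hsl]
    refine hc.hasDerivAt_max ha hb.neg hp (fun x z hz => ?_) (fun x z hz h => ?_) x
    · have h : slope x z ≤ slope x (p x) := hmp x hz
      rw [hsl, hsl] at h
      exact h
    · refine eq_of_isMaxOn_slope hS hz (hp x) (fun w hw => ?_) (hmp x)
      show slope x w ≤ slope x z
      rw [hsl, hsl]
      exact h w hw
  have hQ : ∀ x, HasDerivAt (fun y => -slope y (q y)) (1 / (q x).im) x := by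
    intro x
    have hsl' : ∀ x (z : ℍ), -slope x z = -(z.re / z.im) + x * (1 / z.im) := fun x z => by
      rw [hsl]; ring
    simp only [hsl']
    refine hc.hasDerivAt_max ha.neg hb hq (fun x z hz => ?_) (fun x z hz h => ?_) x
    · have h : -slope x z ≤ -slope x (q x) := neg_le_neg (hmq x hz)
      rw [hsl', hsl'] at h
      exact h
    · refine eq_of_isMinOn_slope hS hz (hq x) (fun w hw => ?_) (hmq x)
      show slope x z ≤ slope x w
      rw [← neg_le_neg_iff, hsl', hsl']
      exact h w hw
  have hder : ∀ x, HasDerivAt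
      (fun y => Real.arsinh (slope y (p y)) - Real.arsinh (slope y (q y))) 0 x := by
    intro x
    have hQ' : HasDerivAt (fun y => slope y (q y)) (-(1 / (q x).im)) x := by
      simpa using (hQ x).fun_neg
    have h := (hP x).arsinh.fun_sub hQ'.arsinh
    simp only [sqrt_one_add_slope_sq, smul_eq_mul] at h
    have hr : 0 < dist (x : ℂ) (q x) := dist_pos.2 (ne_ofReal (q x) x).symm
    have := (p x).im_pos
    have := (q x).im_pos
    rw [heq x] at h
    -- Each product is `-1 / dist x (q x)`: the heights cancel and only the common tangent length
    -- remains.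
    have h0 : (dist (x : ℂ) (q x) / (p x).im)⁻¹ * -(1 / (p x).im) -
        (dist (x : ℂ) (q x) / (q x).im)⁻¹ * -(1 / (q x).im) = 0 := by
      field_simp
      ring
    rwa [h0] at h
  refine ⟨Real.arsinh (slope 0 (p 0)) - Real.arsinh (slope 0 (q 0)), fun x => ?_⟩
  exact is_const_of_deriv_eq_zero (fun x => (hder x).differentiableAt) (fun x => (hder x).deriv)
    x 0

/-- The bound is attained at the point `x` where the perpendicular bisector of `z` and `w` meets the
axis. For points on one vertical, `x` recedes to infinity and the error term tends to zero. -/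
lemma dist_le_of_abs_arsinh_slope_sub_le {z w : ℍ} {d : ℝ} (hd : 0 ≤ d)
    (h : ∀ x, |Real.arsinh (slope x z) - Real.arsinh (slope x w)| ≤ d) : dist z w ≤ d := by
  have hz := z.im_pos
  have hw := w.im_pos
  by_cases hre : z.re = w.re
  · suffices hcosh : Real.cosh (dist z w) ≤ Real.cosh d by
      rwa [Real.cosh_le_cosh, abs_of_nonneg dist_nonneg, abs_of_nonneg hd] at hcosh
    set c := (z.im ^ 2 - w.im ^ 2) ^ 2 / (2 * z.im * w.im)
    have hbound : ∀ n : ℝ, 0 < n → Real.cosh (dist z w) ≤ Real.cosh d + c * (n⁻¹) ^ 2 := by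
      intro n hn
      set x := z.re - n
      have h1 : Real.cosh (Real.arsinh (slope x z) - Real.arsinh (slope x w)) ≤ Real.cosh d :=
        Real.cosh_le_cosh.2 ((h x).trans (le_abs_self d))
      have hzx := dist_sq_ofReal x z
      have hwx := dist_sq_ofReal x w
      rw [← hre] at hwx
      have hn' : z.re - x = n := by simp [x]
      rw [hn'] at hzx hwx
      rw [cosh_dist_eq_cosh_sub_add x z w]
      set ρ := dist (x : ℂ) z
      set σ := dist (x : ℂ) w
      have hρ : 0 ≤ ρ := dist_nonneg
      have hσ : 0 ≤ σ := dist_nonneg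
      have h2 : (ρ - σ) ^ 2 * n ^ 2 ≤ (z.im ^ 2 - w.im ^ 2) ^ 2 := by
        have e : z.im ^ 2 - w.im ^ 2 = (ρ - σ) * (ρ + σ) := by linear_combination hwx - hzx
        rw [e, mul_pow]
        refine mul_le_mul_of_nonneg_left ?_ (sq_nonneg _)
        nlinarith [mul_nonneg hρ hσ]
      have h3 : (ρ - σ) ^ 2 / (2 * z.im * w.im) ≤ c * (n⁻¹) ^ 2 := by
        rw [inv_pow, ← div_eq_mul_inv, le_div_iff₀ (by positivity), div_mul_eq_mul_div]
        exact div_le_div_of_nonneg_right h2 (by positivity)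
      linarith
    have hlim : Tendsto (fun n : ℝ => Real.cosh d + c * (n⁻¹) ^ 2) atTop (𝓝 (Real.cosh d)) := by
      simpa using tendsto_const_nhds.add ((tendsto_inv_atTop_zero.pow 2).const_mul c)
    exact ge_of_tendsto hlim ((eventually_gt_atTop 0).mono hbound)
  · obtain ⟨x, hx⟩ : ∃ x, x = (z.re ^ 2 + z.im ^ 2 - w.re ^ 2 - w.im ^ 2) / (2 * (z.re - w.re)) :=
      ⟨_, rfl⟩
    have hne : z.re - w.re ≠ 0 := sub_ne_zero.2 hre
    have hx' : x * (2 * (z.re - w.re)) = z.re ^ 2 + z.im ^ 2 - w.re ^ 2 - w.im ^ 2 := by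
      rw [hx]; field_simp
    have hxd : dist (x : ℂ) z = dist (x : ℂ) w := by
      rw [← sq_eq_sq₀ dist_nonneg dist_nonneg, dist_sq_ofReal, dist_sq_ofReal]
      linear_combination -hx'
    rw [dist_eq_abs_arsinh_slope_sub hxd]
    exact h x

/-- The contact points of the two horizontal support lines, as limits of contact points of tangent
segments. -/
lemma exists_im_extremal (hc : IsCompact K) {p q : ℝ → ℍ} (hp : ∀ x, p x ∈ K)
    (hq : ∀ x, q x ∈ K) (hmp : ∀ x, IsMaxOn (slope x) K (p x))
    (hmq : ∀ x, IsMinOn (slope x) K (q x))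
    (heq : ∀ x : ℝ, dist (x : ℂ) (p x) = dist (x : ℂ) (q x)) {d : ℝ}
    (hd : ∀ x, dist (p x) (q x) = d) :
    ∃ t ∈ K, ∃ b ∈ K, IsMaxOn im K t ∧ IsMinOn im K b ∧ t.re = b.re ∧ dist t b = d := by
  -- An ultrafilter finer than `atTop` makes `p` and `q` converge simultaneously.
  let U : Ultrafilter ℝ := Ultrafilter.of atTop
  have hU : (U : Filter ℝ) ≤ atTop := Ultrafilter.of_le atTop
  obtain ⟨t, ht, hpt⟩ := hc.ultrafilter_le_nhds (U.map p)
    (le_principal_iff.2 (Ultrafilter.mem_map.2 (Eventually.of_forall hp)))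
  obtain ⟨b, hb, hqb⟩ := hc.ultrafilter_le_nhds (U.map q)
    (le_principal_iff.2 (Ultrafilter.mem_map.2 (Eventually.of_forall hq)))
  have hpt : Tendsto p U (𝓝 t) := hpt
  have hqb : Tendsto q U (𝓝 b) := hqb
  have hinv : Tendsto (fun x : ℝ => x⁻¹) U (𝓝 0) := tendsto_inv_atTop_zero.mono_left hU
  have hpos : ∀ᶠ x : ℝ in U, 0 < x := hU (eventually_gt_atTop 0)
  have hpre := (continuous_re.tendsto t).comp hpt
  have hpim := (continuous_im.tendsto t).comp hpt
  have hqre := (continuous_re.tendsto b).comp hqb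
  have hqim := (continuous_im.tendsto b).comp hqb
  refine ⟨t, ht, b, hb, fun z hz => ?_, fun z hz => ?_, ?_, ?_⟩
  · have h1 : Tendsto (fun x => (z.re * (p x).im - (p x).re * z.im) * x⁻¹) U (𝓝 0) := by
      simpa using ((hpim.const_mul z.re).sub (hpre.mul_const z.im)).mul hinv
    have h2 : Tendsto (fun x => (p x).im - z.im) U (𝓝 (t.im - z.im)) := hpim.sub_const _
    refine sub_nonneg.1 (le_of_tendsto_of_tendsto h1 h2 ?_)
    filter_upwards [hpos] with x hx
    have h : slope x z ≤ slope x (p x) := hmp x hz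
    rw [slope, slope, div_le_div_iff₀ z.im_pos (p x).im_pos] at h
    rw [← div_eq_mul_inv, div_le_iff₀ hx]
    linarith
  · have h1 : Tendsto (fun x => ((q x).re * z.im - z.re * (q x).im) * x⁻¹) U (𝓝 0) := by
      simpa using ((hqre.mul_const z.im).sub (hqim.const_mul z.re)).mul hinv
    have h2 : Tendsto (fun x => z.im - (q x).im) U (𝓝 (z.im - b.im)) := hqim.const_sub _
    refine sub_nonneg.1 (le_of_tendsto_of_tendsto h1 h2 ?_)
    filter_upwards [hpos] with x hx
    have h : slope x (q x) ≤ slope x z := hmq x hz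
    rw [slope, slope, div_le_div_iff₀ (q x).im_pos z.im_pos] at h
    rw [← div_eq_mul_inv, div_le_iff₀ hx]
    linarith
  -- Equality of the squared tangent lengths, divided by `x`, tends to `-2 * (t.re - b.re) = 0`.
  · have h1 : Tendsto (fun x => ((q x).im ^ 2 - (p x).im ^ 2) * x⁻¹) U (𝓝 0) := by
      simpa using ((hqim.pow 2).sub (hpim.pow 2)).mul hinv
    have h2 : Tendsto (fun x => ((p x).re - (q x).re) * (((p x).re + (q x).re) * x⁻¹ - 2)) U
        (𝓝 ((t.re - b.re) * ((t.re + b.re) * 0 - 2))) :=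
      (hpre.sub hqre).mul (((hpre.add hqre).mul hinv).sub_const 2)
    have h3 := tendsto_nhds_unique_of_eventuallyEq h1 h2 (by
      filter_upwards [hpos] with x hx
      have hpx := dist_sq_ofReal x (p x)
      have hqx := dist_sq_ofReal x (q x)
      rw [heq x] at hpx
      field_simp
      linear_combination hpx - hqx)
    linarith
  · exact tendsto_nhds_unique (hpt.dist hqb) (by simp only [hd]; exact tendsto_const_nhds)

/-- Points outside the body are at distance greater than `d` from some point of the body. -/
lemma exists_lt_dist_of_notMem (hc : IsCompact K) (hconv : Convex ℝ ((↑) '' K : Set ℂ))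
    {p q : ℝ → ℍ} (hp : ∀ x, p x ∈ K) (hq : ∀ x, q x ∈ K) {d : ℝ}
    (hd : ∀ x, Real.arsinh (slope x (p x)) - Real.arsinh (slope x (q x)) = d) {t b : ℍ}
    (ht : t ∈ K) (hb : b ∈ K) (hre : t.re = b.re) (htb : dist t b = d)
    (hle : b.im ≤ t.im) {u : ℍ} (hu : u ∉ K) : ∃ z ∈ K, d < dist z u := by
  have hu' : (u : ℂ) ∉ ((↑) '' K : Set ℂ) := by
    rintro ⟨v, hv, hvu⟩
    exact hu (coe_inj.1 hvu ▸ hv)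
  obtain ⟨f, c, hfK, hfu⟩ := geometric_hahn_banach_closed_point hconv
    (hc.image continuous_coe).isClosed hu'
  obtain ⟨α, hα⟩ : ∃ α, α = f 1 := ⟨_, rfl⟩
  obtain ⟨β, hβ⟩ : ∃ β, β = f Complex.I := ⟨_, rfl⟩
  have hf : ∀ z : ℍ, f z = α * z.re + β * z.im := by
    intro z
    have h : (z : ℂ) = z.re • (1 : ℂ) + z.im • Complex.I := by
      apply Complex.ext <;> simp
    rw [h, map_add, map_smul, map_smul, hα, hβ, smul_eq_mul, smul_eq_mul]
    ring
  have hK : ∀ z ∈ K, α * z.re + β * z.im < c := fun z hz => by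
    rw [← hf]; exact hfK _ ⟨z, hz, rfl⟩
  rw [hf] at hfu
  have hu0 := u.im_pos
  have ht0 := t.im_pos
  have hb0 := b.im_pos
  rw [dist_of_re_eq hre, Real.dist_eq,
    abs_of_nonneg (sub_nonneg.2 (Real.log_le_log hb0 hle))] at htb
  rcases lt_trichotomy α 0 with h0 | h0 | h0
  · refine ⟨p (c / α), hp _, ?_⟩
    have hα0 : α ≠ 0 := h0.ne
    have hmul : ∀ y, α * (-β / α * y) = -β * y := fun y => by field_simp
    have hsub : ∀ y, α * (y - c / α) = α * y - c := fun y => by field_simp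
    have h1 := hK _ (hq (c / α))
    have h2 : slope (c / α) u < slope (c / α) (q (c / α)) := by
      have := (q (c / α)).im_pos
      have e1 : slope (c / α) u < -β / α := by
        rw [slope, div_lt_iff₀ hu0]
        refine (mul_lt_mul_left_of_neg h0).1 ?_
        rw [hmul, hsub]
        linarith
      have e2 : -β / α < slope (c / α) (q (c / α)) := by
        rw [slope, lt_div_iff₀ this]
        refine (mul_lt_mul_left_of_neg h0).1 ?_
        rw [hmul, hsub]
        linarith
      exact e1.trans e2
    have h3 := (le_abs_self _).trans (abs_arsinh_slope_sub_le (c / α) (p (c / α)) u)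
    have h4 := Real.arsinh_lt_arsinh.2 h2
    linarith [hd (c / α)]
  · rw [h0] at hfu hK
    -- The separating line is horizontal: `u` is below `b` or above `t`, and logarithms of heights
    -- bound the distance.
    rcases lt_trichotomy β 0 with hβ0 | hβ0 | hβ0
    · refine ⟨t, ht, ?_⟩
      have h1 : u.im < b.im := by
        have := hK b hb
        nlinarith
      have h2 := (le_abs_self _).trans (dist_log_im_le t u)
      linarith [Real.log_lt_log hu0 h1]
    · have := hK b hb
      rw [hβ0] at this hfu
      linarith
    · refine ⟨b, hb, ?_⟩
      have h1 : t.im < u.im := by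
        have := hK t ht
        nlinarith
      have h2 := (le_abs_self _).trans (dist_log_im_le u b)
      rw [dist_comm]
      linarith [Real.log_lt_log ht0 h1]
  · refine ⟨q (c / α), hq _, ?_⟩
    have h1 := hK _ (hp (c / α))
    have h2 : slope (c / α) (p (c / α)) < slope (c / α) u := by
      have := (p (c / α)).im_pos
      have e1 : -β / α < slope (c / α) u := by
        rw [slope, lt_div_iff₀ hu0]
        refine lt_of_mul_lt_mul_left ?_ h0.le
        field_simp
        linarith
      have e2 : slope (c / α) (p (c / α)) < -β / α := by
        rw [slope, div_lt_iff₀ this]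
        refine lt_of_mul_lt_mul_left ?_ h0.le
        field_simp
        linarith
      exact e2.trans e1
    have h3 := (le_abs_self _).trans (abs_arsinh_slope_sub_le (c / α) u (q (c / α)))
    have h4 := Real.arsinh_lt_arsinh.2 h2
    rw [dist_comm]
    linarith [hd (c / α)]

/-- The Euclidean tangent line of a supporting geodesic supports a Euclidean convex body. -/
lemma tangent_le_of_linForm_le (hconv : Convex ℝ ((↑) '' K : Set ℂ)) {A B C : ℝ} {p z : ℍ}
    (hp : p ∈ K) (hz : z ∈ K) (hp0 : linForm A B C p = 0)
    (hle : ∀ y ∈ K, linForm A B C y ≤ 0) :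
    (2 * A * p.re + B) * (z.re - p.re) + 2 * A * p.im * (z.im - p.im) ≤ 0 := by
  have hnum : A * (p.re ^ 2 + p.im ^ 2) + B * p.re + C = 0 := by
    simpa [linForm, p.im_ne_zero] using hp0
  -- This is the inequality at the point `(1 - t) p + t z` of the body, divided by `t`; the
  -- second-order term disappears as `t → 0`.
  have hseg : ∀ t : ℝ, 0 < t → t < 1 →
      (2 * A * p.re + B) * (z.re - p.re) + 2 * A * p.im * (z.im - p.im) +
        t * (A * ((z.re - p.re) ^ 2 + (z.im - p.im) ^ 2)) ≤ 0 := by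
    intro t ht0 ht1
    obtain ⟨y, hy, hyz⟩ := hconv ⟨p, hp, rfl⟩ ⟨z, hz, rfl⟩ (sub_nonneg.2 ht1.le) ht0.le
      (by ring : 1 - t + t = 1)
    have hre : y.re = (1 - t) * p.re + t * z.re := by
      rw [← coe_re, hyz]; simp
    have him : y.im = (1 - t) * p.im + t * z.im := by
      rw [← coe_im, hyz]; simp
    have h := hle y hy
    rw [linForm, div_le_iff₀ y.im_pos, zero_mul, hre, him] at h
    refine le_of_mul_le_mul_left ?_ ht0
    linear_combination h - hnum
  have hlim : Tendsto (fun t : ℝ =>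
      (2 * A * p.re + B) * (z.re - p.re) + 2 * A * p.im * (z.im - p.im) +
        t * (A * ((z.re - p.re) ^ 2 + (z.im - p.im) ^ 2))) (𝓝[>] 0)
      (𝓝 ((2 * A * p.re + B) * (z.re - p.re) + 2 * A * p.im * (z.im - p.im))) := by
    have : ContinuousAt (fun t : ℝ =>
      (2 * A * p.re + B) * (z.re - p.re) + 2 * A * p.im * (z.im - p.im) +
        t * (A * ((z.re - p.re) ^ 2 + (z.im - p.im) ^ 2))) 0 := by fun_prop
    have h := this.tendsto
    simp only [zero_mul, add_zero] at h
    exact h.mono_left nhdsWithin_le_nhds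
  refine le_of_tendsto hlim ?_
  filter_upwards [Ioo_mem_nhdsGT one_pos] with t ht using hseg t ht.1 ht.2

/-- The hyperbolic Pythagorean theorem for the right angle between the circle about `x` through
`p` and the geodesic tangent at `p` to the straight line through `x` and `p`. -/
lemma cosh_dist_eq_mul {x : ℝ} {p q w : ℍ} (hpq : dist (x : ℂ) p = dist (x : ℂ) q)
    (hw : slope x w = slope x p * Real.cosh (dist p w)) :
    Real.cosh (dist q w) = Real.cosh (dist q p) * Real.cosh (dist p w) := by
  have hp0 := p.im_pos
  have hq0 := q.im_pos
  have hw0 := w.im_pos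
  have h := dist_sq_ofReal x p
  rw [hpq, dist_sq_ofReal] at h
  simp only [slope, cosh_dist_eq] at hw ⊢
  obtain ⟨a, ha⟩ : ∃ a, a = p.re - x := ⟨_, rfl⟩
  obtain ⟨b, hb⟩ : ∃ b, b = q.re - x := ⟨_, rfl⟩
  obtain ⟨c, hcw⟩ : ∃ c, c = w.re - x := ⟨_, rfl⟩
  rw [show p.re - w.re = a - c by rw [ha, hcw]; ring, ← ha, ← hcw] at hw
  rw [← ha, ← hb] at h
  rw [show p.re - w.re = a - c by rw [ha, hcw]; ring,
    show q.re - p.re = b - a by rw [ha, hb]; ring,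
    show q.re - w.re = b - c by rw [hb, hcw]; ring]
  have hq2 : q.im ^ 2 = a ^ 2 + p.im ^ 2 - b ^ 2 := by linarith
  rw [hq2]
  field_simp at hw ⊢
  linear_combination (2 * (a - b)) * hw

/-- Here `x` is the point where the Euclidean tangent at `p` to the geodesic meets the axis; the
conclusion is the equation of that geodesic in the form used by `cosh_dist_eq_mul`. -/
lemma slope_eq_of_linForm_eq_zero {A B C : ℝ} {p w : ℍ} (hp0 : linForm A B C p = 0)
    (hw0 : linForm A B C w = 0) (hμ : 2 * A * p.re + B ≠ 0) {x : ℝ}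
    (hx : x = p.re + 2 * A * p.im ^ 2 / (2 * A * p.re + B)) :
    slope x w = slope x p * Real.cosh (dist p w) := by
  have hp := p.im_pos
  have hw := w.im_pos
  have h1 : A * (p.re ^ 2 + p.im ^ 2) + B * p.re + C = 0 := by
    simpa [linForm, p.im_ne_zero] using hp0
  have h2 : A * (w.re ^ 2 + w.im ^ 2) + B * w.re + C = 0 := by
    simpa [linForm, w.im_ne_zero] using hw0
  obtain ⟨k, hk⟩ : ∃ k, k = 2 * A * p.im ^ 2 / (2 * A * p.re + B) := ⟨_, rfl⟩
  rw [cosh_dist_eq, slope, slope, hx, ← hk]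
  rw [eq_div_iff hμ] at hk
  field_simp
  refine mul_left_cancel₀ hμ ?_
  linear_combination (2 * p.im ^ 2) * (h2 - h1) +
    ((p.re - w.re) ^ 2 + w.im ^ 2 - p.im ^ 2) * hk

theorem isHypConstantWidthBody_of_dist_eq (hc : IsCompact K)
    (hS : StrictConvex ℝ ((↑) '' K : Set ℂ)) (hint : (interior K).Nonempty)
    (heq : ∀ x : ℝ, ∀ p ∈ K, ∀ q ∈ K, IsMaxOn (slope x) K p → IsMinOn (slope x) K q →
      dist (x : ℂ) p = dist (x : ℂ) q) : IsHypConstantWidthBody K := by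
  have hne : K.Nonempty := hint.mono interior_subset
  choose p hp hmp using fun x => hc.exists_isMaxOn hne (continuous_slope x).continuousOn
  choose q hq hmq using fun x => hc.exists_isMinOn hne (continuous_slope x).continuousOn
  have hpq : ∀ x : ℝ, dist (x : ℂ) (p x) = dist (x : ℂ) (q x) := fun x =>
    heq x _ (hp x) _ (hq x) (hmp x) (hmq x)
  obtain ⟨d, hd⟩ := exists_arsinh_slope_sub_eq hc hS hp hq hmp hmq hpq
  have hd0 : 0 ≤ d := by
    rw [← hd 0, sub_nonneg]
    exact Real.arsinh_le_arsinh.2 (hmp 0 (hq 0))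
  have hdist : ∀ x, dist (p x) (q x) = d := fun x => by
    rw [dist_eq_abs_arsinh_slope_sub (hpq x), hd, abs_of_nonneg hd0]
  have hdiam : ∀ z ∈ K, ∀ w ∈ K, dist z w ≤ d := fun z hz w hw => by
    refine dist_le_of_abs_arsinh_slope_sub_le hd0 fun x => abs_sub_le_iff.2 ?_
    have h1 := Real.arsinh_le_arsinh.2 (hmp x hz)
    have h2 := Real.arsinh_le_arsinh.2 (hmp x hw)
    have h3 := Real.arsinh_le_arsinh.2 (hmq x hz)
    have h4 := Real.arsinh_le_arsinh.2 (hmq x hw)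
    constructor <;> linarith [hd x]
  obtain ⟨t, ht, b, hb, hmt, hmb, hre, htb⟩ := exists_im_extremal hc hp hq hmp hmq hpq hdist
  refine ⟨⟨hc, hint, fun z hz w hw u hu => ?_⟩, d, fun L hL => ?_⟩
  · by_contra huK
    obtain ⟨c, hcK, hcu⟩ :=
      exists_lt_dist_of_notMem hc hS.convex hp hq hd ht hb hre htb (hmt hb) huK
    exact hcu.not_ge (cosh_dist_le_of_mem_hypSegment hu (hdiam c hcK z hz) (hdiam c hcK w hw))
  obtain ⟨o, hoL, hoK⟩ := hL.1
  refine le_antisymm ?_ ?_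
  · obtain ⟨z, hz, hzw⟩ := exists_infDist_eq_hypWidth hc hne L
    rw [← hzw]
    exact (Metric.infDist_le_dist_of_mem hoL).trans (hdiam z hz o hoK)
  suffices h : ∃ z ∈ K, ∀ w ∈ L.points, d ≤ dist z w by
    obtain ⟨z, hz, hzw⟩ := h
    exact ((Metric.le_infDist ⟨o, hoL⟩).2 fun w => hzw w).trans (infDist_le_hypWidth hc L hz)
  obtain ⟨A, B, C, hD, hLp, hle⟩ := HypLine.exists_linForm_of_supports hL
  have ho0 : linForm A B C o = 0 := by rw [hLp] at hoL; exact hoL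
  have htan := fun z hz => tangent_le_of_linForm_le hS.convex (z := z) hoK hz ho0 hle
  have ho := o.im_pos
  by_cases hμ : 2 * A * o.re + B = 0
  · -- horizontal tangent line
    have hA : A ≠ 0 := by
      rintro rfl
      have : B = 0 := by simpa using hμ
      simp [this] at hD
    -- `o` is the apex of the semicircle, so the vertical through `o` is perpendicular to `L` and
    -- every point of it has foot `o`.
    have hlow : ∀ z : ℍ, o.re = z.re → ∀ w ∈ L.points, dist z o ≤ dist z w := by
      intro z hz w hw
      have hw0 : linForm A B C w = 0 := by rw [hLp] at hw; exact hw
      have h1 : A * (o.re ^ 2 + o.im ^ 2) + B * o.re + C = 0 := by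
        simpa [linForm, o.im_ne_zero] using ho0
      have h2 : A * (w.re ^ 2 + w.im ^ 2) + B * w.re + C = 0 := by
        simpa [linForm, w.im_ne_zero] using hw0
      have h3 : (w.re - o.re) ^ 2 + w.im ^ 2 = o.im ^ 2 := by
        refine mul_left_cancel₀ hA ?_
        linear_combination h2 - h1 + (o.re - w.re) * hμ
      have hw := w.im_pos
      have hz0 := z.im_pos
      have h4 : w.im ≤ o.im := by
        refine le_of_sq_le_sq ?_ ho.le
        nlinarith [sq_nonneg (w.re - o.re)]
      rw [← cosh_dist_le_cosh, cosh_dist_eq, cosh_dist_eq, ← hz]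
      have h5 : (o.re - w.re) ^ 2 + z.im ^ 2 + w.im ^ 2 =
          (o.re - o.re) ^ 2 + z.im ^ 2 + o.im ^ 2 := by linear_combination h3
      rw [h5]
      gcongr
    rcases lt_or_gt_of_ne hA with hA | hA
    · have hmo : IsMinOn im K o := fun z hz => by
        have h := htan z hz
        rw [hμ, zero_mul, zero_add] at h
        show o.im ≤ z.im
        by_contra! hlt
        nlinarith [mul_pos (mul_pos (neg_pos.2 hA) ho) (sub_pos.2 hlt)]
      obtain rfl := eq_of_isMinOn_im hS hoK hb hmo hmb
      exact ⟨t, ht, fun w hw => htb ▸ hlow t hre.symm w hw⟩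
    · have hmo : IsMaxOn im K o := fun z hz => by
        have h := htan z hz
        rw [hμ, zero_mul, zero_add] at h
        show z.im ≤ o.im
        by_contra! hlt
        nlinarith [mul_pos (mul_pos hA ho) (sub_pos.2 hlt)]
      obtain rfl := eq_of_isMaxOn_im hS hoK ht hmo hmt
      exact ⟨b, hb, fun w hw => by rw [← htb, dist_comm]; exact hlow b hre w hw⟩
  · obtain ⟨x, hx⟩ : ∃ x, x = o.re + 2 * A * o.im ^ 2 / (2 * A * o.re + B) := ⟨_, rfl⟩
    have hpyth : ∀ z : ℍ, dist (x : ℂ) o = dist (x : ℂ) z → dist z o = d →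
        ∀ w ∈ L.points, d ≤ dist z w := by
      intro z hxz hzo w hw
      have hw0 : linForm A B C w = 0 := by rw [hLp] at hw; exact hw
      rw [← hzo, ← cosh_dist_le_cosh,
        cosh_dist_eq_mul hxz (slope_eq_of_linForm_eq_zero ho0 hw0 hμ hx)]
      exact le_mul_of_one_le_right (Real.cosh_pos _).le (Real.one_le_cosh _)
    have hsl : ∀ z : ℍ, (2 * A * o.re + B) * (slope x z - slope x o) * z.im =
        (2 * A * o.re + B) * (z.re - o.re) + 2 * A * o.im * (z.im - o.im) := by
      intro z
      have hz := z.im_pos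
      rw [slope, slope, hx]
      field_simp
      ring
    have hsl' : ∀ z ∈ K, (2 * A * o.re + B) * (slope x z - slope x o) ≤ 0 := fun z hz =>
      nonpos_of_mul_nonpos_left ((hsl z).trans_le (htan z hz)) z.im_pos
    -- The sign tells on which side of its tangent line `K` lies, hence whether `o` is the minimizer
    -- or the maximizer for `x`; the opposite contact point realizes the width.
    rcases lt_or_gt_of_ne hμ with hμ | hμ
    · have hmo : IsMinOn (slope x) K o := fun z hz => by
        show slope x o ≤ slope x z
        by_contra! hlt
        nlinarith [hsl' z hz, mul_pos (neg_pos.2 hμ) (sub_pos.2 hlt)]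
      obtain rfl := eq_of_isMinOn_slope hS hoK (hq x) hmo (hmq x)
      exact ⟨p x, hp x, hpyth _ (hpq x).symm (hdist x)⟩
    · have hmo : IsMaxOn (slope x) K o := fun z hz => by
        show slope x z ≤ slope x o
        by_contra! hlt
        nlinarith [hsl' z hz, mul_pos hμ (sub_pos.2 hlt)]
      obtain rfl := eq_of_isMaxOn_slope hS hoK (hp x) hmo (hmp x)
      exact ⟨q x, hq x, hpyth _ (hpq x) (by rw [dist_comm]; exact hdist x)⟩

end UpperHalfPlane

/-! ### From the curve to the body that it bounds -/

open UpperHalfPlane in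
theorem lemma2 (γ : Set ℂ) (hγ : IsStrictlyConvexClosedCurve γ) (hpos : ∀ z ∈ γ, 0 < z.im) :
    (∀ x : ℝ, EqualTangentSegments γ (x : ℂ)) ↔ IsHypConstantWidthCurve γ := by
  obtain ⟨S, hSc, hS, hSint, rfl⟩ := hγ
  have hhull := hSc.convexHull_frontier hS.convex
  have hSpos : ∀ z ∈ S, 0 < z.im := by
    rw [← hhull]
    exact convexHull_min hpos (convex_halfSpace_im_gt 0)
  rw [IsHypConstantWidthCurve, hhull]
  set K : Set ℍ := {z : ℍ | (z : ℂ) ∈ S} with hK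
  have hKS : ((↑) '' K : Set ℂ) = S := by
    ext z
    constructor
    · rintro ⟨w, hw, rfl⟩
      exact hw
    · exact fun hz => ⟨⟨z, hSpos z hz⟩, hz, rfl⟩
  have hc : IsCompact K := by
    rw [isEmbedding_coe.isCompact_iff, hKS]
    exact hSc
  have hint : (interior K).Nonempty := by
    obtain ⟨z, hz⟩ := hSint
    exact ⟨⟨z, hSpos z (interior_subset hz)⟩,
      preimage_interior_subset_interior_preimage continuous_coe hz⟩
  rw [← hKS] at hS ⊢
  simp only [equalTangentSegments_iff hc hS]
  exact ⟨isHypConstantWidthBody_of_dist_eq hc hS hint,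
    fun h x p hp q hq hmp hmq => dist_eq_of_isHypConstantWidthBody hS h hp hq hmp hmq⟩
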